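/- Let $\tau\in\mathbb{C}$ with $\operatorname{Im}\tau>0$. Let $H_3(\mathbb{R})=\mathbb{C}\times\mathbb{R}$ be the Heisenberg group with multiplication $(z_1,t_1)\cdot(z_2,t_2)=(z_1+z_2,\;t_1+t_2+\operatorname{Im}(\bar z_1z_2))$, let $H_3(\mathbb{Z})$ be the subgroup generated by $(1,0)$ and $(\tau,0)$, and let $M_3=H_3(\mathbb{R})/H_3(\mathbb{Z})$ be the space of left cosets $gH_3(\mathbb{Z})$, so that $C^\infty(M_3)$ is the set of complex-valued smooth functions $f(z,t)$ on $\mathbb{C}\times\mathbb{R}$ that are invariant under right multiplication by $H_3(\mathbb{Z})$. For $n\in\mathbb{Z}$ let $$A_n=\Big\{f\in C^\infty(M_3)\;:\;\tfrac{\operatorname{Im}\tau}{\pi i}\,\tfrac{\partial f}{\partial t}=nf\Big\}.$$ For $n\neq0$ let $\mathcal{S}(\mathbb{R}\times\mathbb{Z}/n\mathbb{Z})$ be the set of functions $g\colon\mathbb{R}\times\mathbb{Z}/n\mathbb{Z}\to\mathbb{C}$ such that $g(\,\cdot\,;k)$ is a Schwartz function on $\mathbb{R}$ for every $k\in\mathbb{Z}/n\mathbb{Z}$.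 Then for every integer $n\neq0$ there is a bijection $A_n\to\mathcal{S}(\mathbb{R}\times\mathbb{Z}/n\mathbb{Z})$, $f\mapsto\widetilde f$, such that for all $f\in A_n$ and all $x,y,t\in\mathbb{R}$, with $z=x+\tau y$, $$f(z,t)=e^{\pi in\left(\frac{t}{\operatorname{Im}\tau}+xy\right)}\sum_{k\in\mathbb{Z}}e^{2\pi ikx}\,\widetilde f\big(y+\tfrac{k}{n};k\big),$$ where the series converges absolutely. -/

import Mathlib

open scoped ContDiff

/-- The real Heisenberg group `H₃(ℝ)` in its complex parametrization: the set `ℂ × ℝ`. -/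
@[ext]
structure Heis where
  z : ℂ
  t : ℝ

namespace Heis

/-- `(z₁, t₁) · (z₂, t₂) = (z₁ + z₂, t₁ + t₂ + Im (conj z₁ * z₂))`. -/
instance : Mul Heis :=
  ⟨fun a b => ⟨a.z + b.z, a.t + b.t + ((starRingEnd ℂ) a.z * b.z).im⟩⟩

instance : One Heis := ⟨⟨0, 0⟩⟩

instance : Inv Heis := ⟨fun a => ⟨-a.z, -a.t⟩⟩

@[simp] theorem mul_z (a b : Heis) : (a * b).z = a.z + b.z := rfl

@[simp] theorem mul_t (a b : Heis) :
    (a * b).t = a.t + b.t + ((starRingEnd ℂ) a.z * b.z).im := rfl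

@[simp] theorem one_z : (1 : Heis).z = 0 := rfl

@[simp] theorem one_t : (1 : Heis).t = 0 := rfl

@[simp] theorem inv_z (a : Heis) : (a⁻¹).z = -a.z := rfl

@[simp] theorem inv_t (a : Heis) : (a⁻¹).t = -a.t := rfl

instance : Group Heis :=
  Group.ofLeftAxioms
    (fun a b c => by
      ext
      · simp [add_assoc]
      · simp
        ring)
    (fun a => by ext <;> simp)
    (fun a => by
      ext
      · simp
      · simp
        ring)

/-- The subgroup `H₃(ℤ)` generated by `(1, 0)` and `(τ, 0)`. -/
def latticeSubgroup (τ : ℂ) : Subgroup Heis :=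
  Subgroup.closure {(⟨1, 0⟩ : Heis), (⟨τ, 0⟩ : Heis)}

/-- The Heisenberg nilmanifold `M₃ = H₃(ℝ) / H₃(ℤ)`, the space of left cosets `g H₃(ℤ)`. -/
abbrev M3 (τ : ℂ) : Type := Heis ⧸ latticeSubgroup τ

/-- The pullback of a function on `M₃` along `ℂ × ℝ = H₃(ℝ) → M₃`. -/
def pullback {τ : ℂ} (f : M3 τ → ℂ) (p : ℂ × ℝ) : ℂ :=
  f (QuotientGroup.mk (⟨p.1, p.2⟩ : Heis))

/-- `A = C^∞(M₃)`. As `H₃(ℝ) → M₃` is a smooth covering map, a function on `M₃` is smooth exactly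
when its pullback to `H₃(ℝ) = ℂ × ℝ`, a right `H₃(ℤ)`-invariant function, is smooth (in the real
sense). -/
def smoothFunctions (τ : ℂ) : Set (M3 τ → ℂ) :=
  {f | ContDiff ℝ ∞ (pullback f)}

/-- The vector field `𝔱 = (Im τ / (π i)) ∂/∂t` on `H₃(ℝ) = ℂ × ℝ`. -/
noncomputable def tField (τ : ℂ) (F : ℂ × ℝ → ℂ) (p : ℂ × ℝ) : ℂ :=
  ((τ.im : ℂ) / ((Real.pi : ℂ) * Complex.I)) * deriv (fun s : ℝ => F (p.1, s)) p.2

/-- `A_n = {f ∈ A : 𝔱 f = n f}`. -/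
def weightSpace (τ : ℂ) (n : ℤ) : Set (M3 τ → ℂ) :=
  {f | f ∈ smoothFunctions τ ∧
    ∀ p : ℂ × ℝ, tField τ (pullback f) p = (n : ℂ) * pullback f p}

end Heis

/-- The Schwartz space `𝓢(ℝ × ℤ/nℤ)` for `n ≠ 0`: since `ℤ/nℤ` is finite, a function `g(y; k)` on
`ℝ × ℤ/nℤ` is Schwartz when each `g(·; k)` is a Schwartz function on `ℝ`. The value `g(y; k)` is
written `g k y`. -/
abbrev SchwartzRZMod (n : ℤ) : Type := ZMod n.natAbs → SchwartzMap ℝ ℂ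

/-- The term `e^{2 π i k x} g(y + k/n; k)` of the Weil–Brezin–Zak series. -/
noncomputable def zakTerm (n : ℤ) (g : SchwartzRZMod n) (x y : ℝ) (k : ℤ) : ℂ :=
  Complex.exp (2 * (Real.pi : ℂ) * Complex.I * (k : ℂ) * (x : ℂ)) *
    g (k : ZMod n.natAbs) (y + (k : ℝ) / (n : ℝ))

/-!
In the real coordinates `z = x + τ y`, the equation `𝔱 f = n f` says that
`f(z, t) = e^{πin(t/Im τ + xy)} ψ(x, y)` for a unique function `ψ`, and invariance of `f` under the
generators `(1, 0)` and `(τ, 0)` becomes the quasi-periodicity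
`ψ(x + 1, y) = ψ(x, y)`, `ψ(x, y + 1) = e^{-2πinx} ψ(x, y)`.

Expand `ψ(·, y)` in a Fourier series with coefficients `ψ̂_k(y)`. The second quasi-period says
`ψ̂_k(y + 1) = ψ̂_{k+n}(y)`, so `g(y; k) = ψ̂_k(y - k/n)` depends only on `k` modulo `n`, and the
Fourier series of `ψ` is the series of `zakTerm n g`. Smoothness of `ψ` gives decay of `ψ̂_k`, with
all its `y`-derivatives, faster than any power of `k`, uniformly for `y` in `[0, 1]`; as moving `y`
by an integer `m` moves `k` by `m n`, this is exactly Schwartz decay of each coefficient on the line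
(`exists_schwartzMap_eq_fourierCoeffX`, `exists_hasSum_zakTerm`).

Conversely the series of a Schwartz `g` is smooth (`contDiff_zakSum`) and quasi-periodic, hence
defines an element of `A_n` (`Heis.ofSchwartz`), and `g` is recovered from its Fourier coefficients
(`fourierCoeffX_zakSum`). So `Heis.ofSchwartz` is a bijection, and the transform is its inverse.
-/

/-! ### Fourier coefficients in the first variable -/

/-- The partial derivative `∂ψ/∂x` of a function `ψ(x, y)` on `ℝ × ℝ`. -/
noncomputable def partialX (ψ : ℝ × ℝ → ℂ) (p : ℝ × ℝ) : ℂ := fderiv ℝ ψ p (1, 0)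

/-- The partial derivative `∂ψ/∂y` of a function `ψ(x, y)` on `ℝ × ℝ`. -/
noncomputable def partialY (ψ : ℝ × ℝ → ℂ) (p : ℝ × ℝ) : ℂ := fderiv ℝ ψ p (0, 1)

theorem ContDiff.partialX {ψ : ℝ × ℝ → ℂ} (hψ : ContDiff ℝ ∞ ψ) : ContDiff ℝ ∞ (partialX ψ) :=
  (hψ.fderiv_right (m := ∞) (by simp)).clm_apply contDiff_const

theorem ContDiff.partialY {ψ : ℝ × ℝ → ℂ} (hψ : ContDiff ℝ ∞ ψ) : ContDiff ℝ ∞ (partialY ψ) :=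
  (hψ.fderiv_right (m := ∞) (by simp)).clm_apply contDiff_const

theorem ContDiff.iterate_partialY {ψ : ℝ × ℝ → ℂ} (hψ : ContDiff ℝ ∞ ψ) (j : ℕ) :
    ContDiff ℝ ∞ (_root_.partialY^[j] ψ) := by
  induction j with
  | zero => exact hψ
  | succ j ih => rw [Function.iterate_succ_apply']; exact ih.partialY

theorem hasDerivAt_partialX {ψ : ℝ × ℝ → ℂ} (hψ : ContDiff ℝ ∞ ψ) (x y : ℝ) :
    HasDerivAt (fun x => ψ (x, y)) (partialX ψ (x, y)) x :=
  ((hψ.differentiable (by simp)) (x, y)).hasFDerivAt.comp_hasDerivAt x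
    ((hasDerivAt_id x).prodMk (hasDerivAt_const x y))

theorem hasDerivAt_partialY {ψ : ℝ × ℝ → ℂ} (hψ : ContDiff ℝ ∞ ψ) (x y : ℝ) :
    HasDerivAt (fun y => ψ (x, y)) (partialY ψ (x, y)) y :=
  ((hψ.differentiable (by simp)) (x, y)).hasFDerivAt.comp_hasDerivAt y
    ((hasDerivAt_const y x).prodMk (hasDerivAt_id y))

theorem periodic_fderiv_apply {ψ : ℝ × ℝ → ℂ} {c : ℝ × ℝ} (h : Function.Periodic ψ c)
    (v : ℝ × ℝ) : Function.Periodic (fun p => fderiv ℝ ψ p v) c := by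
  intro p
  have h1 : (fun q => ψ (q + c)) = ψ := funext h
  simp only
  rw [← fderiv_comp_add_right c, h1]

theorem periodic_iterate_partialY {ψ : ℝ × ℝ → ℂ} {c : ℝ × ℝ} (h : Function.Periodic ψ c)
    (j : ℕ) : Function.Periodic (partialY^[j] ψ) c := by
  induction j with
  | zero => exact h
  | succ j ih => rw [Function.iterate_succ_apply']; exact periodic_fderiv_apply ih _

/-- The `k`-th Fourier coefficient of `x ↦ ψ(x, y)` over the period `[0, 1]`, as a function
of `y`. -/
noncomputable def fourierCoeffX (ψ : ℝ × ℝ → ℂ) (k : ℤ) (y : ℝ) : ℂ :=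
  ∫ x in (0 : ℝ)..1, Complex.exp (-(2 * (Real.pi : ℂ) * Complex.I * k * x)) * ψ (x, y)

theorem norm_exp_two_pi_I_mul (k : ℤ) (x : ℝ) :
    ‖Complex.exp (2 * (Real.pi : ℂ) * Complex.I * k * x)‖ = 1 := by
  have : 2 * (Real.pi : ℂ) * Complex.I * k * x = ((2 * Real.pi * k * x : ℝ) : ℂ) * Complex.I := by
    push_cast; ring
  rw [this, Complex.norm_exp_ofReal_mul_I]

theorem norm_exp_neg_two_pi_I_mul (k : ℤ) (x : ℝ) :
    ‖Complex.exp (-(2 * (Real.pi : ℂ) * Complex.I * k * x))‖ = 1 := by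
  rw [Complex.exp_neg, norm_inv, norm_exp_two_pi_I_mul, inv_one]

theorem exp_two_pi_I_mul_int (k m : ℤ) :
    Complex.exp (2 * (Real.pi : ℂ) * Complex.I * k * m) = 1 :=
  Complex.exp_eq_one_iff.2 ⟨k * m, by push_cast; ring⟩

theorem hasDerivAt_fourierCoeffX {ψ : ℝ × ℝ → ℂ} (hψ : ContDiff ℝ ∞ ψ) (k : ℤ) (y : ℝ) :
    HasDerivAt (fourierCoeffX ψ k) (fourierCoeffX (partialY ψ) k y) y := by
  have hc := hψ.continuous
  have hc' := hψ.partialY.continuous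
  obtain ⟨C, hC⟩ := (isCompact_Icc.prod (isCompact_Icc (a := y - 1) (b := y + 1))).exists_bound_of_continuousOn
    (s := Set.Icc (0 : ℝ) 1 ×ˢ Set.Icc (y - 1) (y + 1)) hc'.continuousOn
  refine (intervalIntegral.hasDerivAt_integral_of_dominated_loc_of_deriv_le
    (F := fun y x => Complex.exp (-(2 * (Real.pi : ℂ) * Complex.I * k * x)) * ψ (x, y))
    (F' := fun y x => Complex.exp (-(2 * (Real.pi : ℂ) * Complex.I * k * x)) * partialY ψ (x, y))
    (bound := fun _ => C) (s := Set.Icc (y - 1) (y + 1)) (Icc_mem_nhds (by linarith) (by linarith))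
    (.of_forall fun z => ?_) ?_ ?_ (.of_forall ?_) (by simp) (.of_forall ?_)).2
  · exact (Continuous.aestronglyMeasurable (by fun_prop))
  · exact Continuous.intervalIntegrable (by fun_prop) _ _
  · exact (Continuous.aestronglyMeasurable (by fun_prop))
  · intro x hx z hz
    rw [norm_mul, norm_exp_neg_two_pi_I_mul, one_mul]
    rw [Set.uIoc_of_le zero_le_one] at hx
    exact hC (x, z) ⟨⟨hx.1.le, hx.2⟩, hz⟩
  · intro x _ z _
    exact (hasDerivAt_partialY hψ x z).const_mul _

theorem contDiff_fourierCoeffX {ψ : ℝ × ℝ → ℂ} (hψ : ContDiff ℝ ∞ ψ) (k : ℤ) :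
    ContDiff ℝ ∞ (fourierCoeffX ψ k) := by
  rw [contDiff_infty]
  intro m
  induction m generalizing ψ with
  | zero =>
    exact contDiff_zero.2 (continuous_iff_continuousAt.2 fun y =>
      (hasDerivAt_fourierCoeffX hψ k y).continuousAt)
  | succ m ih =>
    have hd : deriv (fourierCoeffX ψ k) = fourierCoeffX (partialY ψ) k :=
      funext fun y => (hasDerivAt_fourierCoeffX hψ k y).deriv
    push_cast
    rw [contDiff_succ_iff_deriv, hd]
    exact ⟨fun y => (hasDerivAt_fourierCoeffX hψ k y).differentiableAt, by simp, ih hψ.partialY⟩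

theorem iteratedDeriv_fourierCoeffX {ψ : ℝ × ℝ → ℂ} (hψ : ContDiff ℝ ∞ ψ) (k : ℤ) (j : ℕ) :
    iteratedDeriv j (fourierCoeffX ψ k) = fourierCoeffX (partialY^[j] ψ) k := by
  induction j generalizing ψ with
  | zero => simp
  | succ j ih =>
    have hd : deriv (fourierCoeffX ψ k) = fourierCoeffX (partialY ψ) k :=
      funext fun y => (hasDerivAt_fourierCoeffX hψ k y).deriv
    rw [iteratedDeriv_succ', hd, ih hψ.partialY, Function.iterate_succ_apply]

theorem fourierCoeffX_partialX {ψ : ℝ × ℝ → ℂ} (hψ : ContDiff ℝ ∞ ψ)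
    (hper : Function.Periodic ψ (1, 0)) (k : ℤ) (y : ℝ) :
    fourierCoeffX (partialX ψ) k y = 2 * (Real.pi : ℂ) * Complex.I * k * fourierCoeffX ψ k y := by
  have hc := hψ.continuous
  have hc' := hψ.partialX.continuous
  have hexp : ∀ x : ℝ, HasDerivAt
      (fun x : ℝ => Complex.exp (-(2 * (Real.pi : ℂ) * Complex.I * k * x)))
      (-(2 * (Real.pi : ℂ) * Complex.I * k) *
        Complex.exp (-(2 * (Real.pi : ℂ) * Complex.I * k * x))) x := by
    intro x
    have h1 : HasDerivAt (fun x : ℝ => -(2 * (Real.pi : ℂ) * Complex.I * k * x))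
        (-(2 * (Real.pi : ℂ) * Complex.I * k)) x := by
      simpa using ((hasDerivAt_id x).ofReal_comp.const_mul (2 * (Real.pi : ℂ) * Complex.I * k)).fun_neg
    rw [mul_comm (-_)]
    exact h1.cexp
  have h01 : ψ (1, y) = ψ (0, y) := by simpa using hper (0, y)
  have he1 : Complex.exp (-(2 * (Real.pi : ℂ) * Complex.I * k)) = 1 := by
    rw [Complex.exp_neg]
    simpa using exp_two_pi_I_mul_int k 1
  unfold fourierCoeffX
  rw [intervalIntegral.integral_mul_deriv_eq_deriv_mul (fun x _ => hexp x)
    (fun x _ => hasDerivAt_partialX hψ x y) (Continuous.intervalIntegrable (by fun_prop) _ _)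
    (Continuous.intervalIntegrable (by fun_prop) _ _)]
  simp only [mul_assoc, neg_mul, intervalIntegral.integral_const_mul, intervalIntegral.integral_neg]
  simp only [mul_assoc] at he1
  simp [he1, h01]

/-- Smoothness in `x` makes the Fourier coefficients decay faster than any power of `k`, uniformly
for `y` in a compact set: each factor `1 + |k|` is absorbed by one more `x`-derivative. -/
theorem exists_fourierCoeffX_bound {ψ : ℝ × ℝ → ℂ} (hψ : ContDiff ℝ ∞ ψ)
    (hper : Function.Periodic ψ (1, 0)) (a : ℕ) {K : Set ℝ} (hK : IsCompact K) :
    ∃ C : ℝ, ∀ k : ℤ, ∀ y ∈ K,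
      (1 + |(k : ℝ)|) ^ a * ‖fourierCoeffX ψ k y‖ ≤ C := by
  induction a generalizing ψ with
  | zero =>
    obtain ⟨C, hC⟩ := (isCompact_Icc.prod hK).exists_bound_of_continuousOn
      (s := Set.Icc (0 : ℝ) 1 ×ˢ K) hψ.continuous.continuousOn
    refine ⟨C, fun k y hy => ?_⟩
    rw [pow_zero, one_mul]
    have := intervalIntegral.norm_integral_le_of_norm_le_const (a := 0) (b := 1) (C := C)
      (f := fun x : ℝ => Complex.exp (-(2 * (Real.pi : ℂ) * Complex.I * k * x)) * ψ (x, y)) (by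
        intro x hx
        rw [norm_mul, norm_exp_neg_two_pi_I_mul, one_mul]
        rw [Set.uIoc_of_le zero_le_one] at hx
        exact hC (x, y) ⟨⟨hx.1.le, hx.2⟩, hy⟩)
    simpa [fourierCoeffX] using this
  | succ a ih =>
    obtain ⟨C₁, h₁⟩ := ih hψ hper
    obtain ⟨C₂, h₂⟩ := ih hψ.partialX (periodic_fderiv_apply hper _)
    refine ⟨C₁ + C₂, fun k y hy => ?_⟩
    have e₁ := h₁ k y hy
    have e₂ := h₂ k y hy
    rw [fourierCoeffX_partialX hψ hper, norm_mul] at e₂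
    have hn : ‖2 * (Real.pi : ℂ) * Complex.I * k‖ = 2 * Real.pi * |(k : ℝ)| := by
      simp [abs_of_pos Real.pi_pos]
    have hk : |(k : ℝ)| ≤ 2 * Real.pi * |(k : ℝ)| := by
      have := Real.pi_gt_three
      nlinarith [abs_nonneg (k : ℝ)]
    rw [hn] at e₂
    have hnn : 0 ≤ (1 + |(k : ℝ)|) ^ a * ‖fourierCoeffX ψ k y‖ := by positivity
    calc (1 + |(k : ℝ)|) ^ (a + 1) * ‖fourierCoeffX ψ k y‖
        = (1 + |(k : ℝ)|) ^ a * ‖fourierCoeffX ψ k y‖ +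
          |(k : ℝ)| * ((1 + |(k : ℝ)|) ^ a * ‖fourierCoeffX ψ k y‖) := by ring
      _ ≤ (1 + |(k : ℝ)|) ^ a * ‖fourierCoeffX ψ k y‖ +
          2 * Real.pi * |(k : ℝ)| * ((1 + |(k : ℝ)|) ^ a * ‖fourierCoeffX ψ k y‖) := by gcongr
      _ ≤ C₁ + C₂ := by linarith

theorem summable_inv_one_add_abs_int_sq : Summable fun k : ℤ => ((1 + |(k : ℝ)|) ^ 2)⁻¹ := by
  refine Summable.of_nonneg_of_le (fun k => by positivity) (fun k => ?_)
    ((Real.summable_one_div_int_pow (p := 2)).2 one_lt_two |>.add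
      (hasSum_ite_eq (0 : ℤ) (1 : ℝ)).summable)
  by_cases hk : k = 0
  · simp [hk]
  · have : (0 : ℝ) < |(k : ℝ)| := by positivity
    simp only [hk, if_false, add_zero, one_div]
    rw [← sq_abs (k : ℝ)]
    gcongr
    linarith

theorem hasSum_fourierCoeffX {ψ : ℝ × ℝ → ℂ} (hψ : ContDiff ℝ ∞ ψ)
    (hper : Function.Periodic ψ (1, 0)) (x y : ℝ) :
    HasSum (fun k : ℤ => Complex.exp (2 * (Real.pi : ℂ) * Complex.I * k * x) * fourierCoeffX ψ k y)
      (ψ (x, y)) := by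
  have hp : Function.Periodic (fun x => ψ (x, y)) (1 : ℝ) := fun x => by simpa using hper (x, y)
  have hcont : Continuous fun x => ψ (x, y) := hψ.continuous.comp (by fun_prop)
  have : Fact ((0 : ℝ) < 1) := ⟨one_pos⟩
  let F : C(AddCircle (1 : ℝ), ℂ) := ⟨hp.lift, continuous_coinduced_dom.2 hcont⟩
  have hF : ∀ x : ℝ, F x = ψ (x, y) := fun x => hp.lift_coe x
  have hcoef : ∀ k, fourierCoeff F k = fourierCoeffX ψ k y := by
    intro k
    rw [fourierCoeff_eq_intervalIntegral _ _ 0]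
    simp only [hF, fourier_coe_apply, fourierCoeffX, zero_add, div_one, one_smul, smul_eq_mul]
    congr 1; ext x; congr 2; push_cast; ring
  have hs : Summable (fourierCoeff F) := by
    obtain ⟨C, hC⟩ := exists_fourierCoeffX_bound hψ hper 2 (isCompact_singleton (x := y))
    refine Summable.of_norm_bounded (summable_inv_one_add_abs_int_sq.mul_left C) fun k => ?_
    rw [hcoef, ← div_eq_mul_inv, le_div_iff₀ (by positivity), mul_comm]
    exact hC k y rfl
  have := has_pointwise_sum_fourier_series_of_summable hs (x : AddCircle (1 : ℝ))
  simpa [hF, hcoef, fourier_coe_apply, mul_comm] using this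

/-! ### Quasi-periodic functions have Schwartz coefficients -/

/-- The quasi-period in `y` turns a shift of `y` into a shift of the index. -/
theorem fourierCoeffX_add_one {ψ : ℝ × ℝ → ℂ} {n : ℤ}
    (hq : ∀ x y, ψ (x, y + 1) = Complex.exp (-(2 * (Real.pi : ℂ) * Complex.I * n * x)) * ψ (x, y))
    (k : ℤ) (y : ℝ) : fourierCoeffX ψ k (y + 1) = fourierCoeffX ψ (k + n) y := by
  unfold fourierCoeffX
  congr 1
  ext x
  rw [hq, ← mul_assoc, ← Complex.exp_add]
  congr 2
  push_cast
  ring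

theorem fourierCoeffX_add_int {ψ : ℝ × ℝ → ℂ} {n : ℤ}
    (hq : ∀ x y, ψ (x, y + 1) = Complex.exp (-(2 * (Real.pi : ℂ) * Complex.I * n * x)) * ψ (x, y))
    (k m : ℤ) (y : ℝ) : fourierCoeffX ψ k (y + m) = fourierCoeffX ψ (k + m * n) y := by
  induction m generalizing k with
  | zero => simp
  | succ m ih =>
    have h := fourierCoeffX_add_one hq k (y + ((m : ℤ) : ℝ))
    rw [ih] at h
    rw [show k + ((m : ℤ) + 1) * n = k + n + m * n by ring, ← h]
    push_cast
    rw [add_assoc]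
  | pred m ih =>
    have h := fourierCoeffX_add_one hq (k - n) (y + ((-m - 1 : ℤ) : ℝ))
    rw [sub_add_cancel, show y + ((-m - 1 : ℤ) : ℝ) + 1 = y + ((-m : ℤ) : ℝ) by push_cast; ring,
      ih] at h
    rw [show k + (-(m : ℤ) - 1) * n = k - n + -m * n by ring]
    exact h.symm

/-- The coefficients of a smooth quasi-periodic function are Schwartz functions of `y`: a shift of
`y` by an integer `m` moves the index `k` by `m * n`, so the decay in `k` over a period is decay
in `y` over the line. -/
theorem exists_schwartzMap_eq_fourierCoeffX {ψ : ℝ × ℝ → ℂ} (hψ : ContDiff ℝ ∞ ψ)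
    (hper : Function.Periodic ψ (1, 0)) {n : ℤ} (hn : n ≠ 0)
    (hq : ∀ x y, ψ (x, y + 1) = Complex.exp (-(2 * (Real.pi : ℂ) * Complex.I * n * x)) * ψ (x, y))
    (r : ℤ) : ∃ g : SchwartzMap ℝ ℂ, ∀ y, g y = fourierCoeffX ψ r y := by
  refine ⟨⟨fourierCoeffX ψ r, contDiff_fourierCoeffX hψ r, fun a j => ?_⟩, fun _ => rfl⟩
  obtain ⟨C, hC⟩ := exists_fourierCoeffX_bound (hψ.iterate_partialY j)
    (periodic_iterate_partialY hper j) a (isCompact_Icc (a := (0 : ℝ)) (b := 1))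
  refine ⟨(1 + |(r : ℝ)|) ^ a * C, fun u => ?_⟩
  rw [norm_iteratedFDeriv_eq_norm_iteratedDeriv]
  have hshift : iteratedDeriv j (fourierCoeffX ψ r) u =
      fourierCoeffX (partialY^[j] ψ) (r + ⌊u⌋ * n) (Int.fract u) := by
    have h1 : (fun z : ℝ => fourierCoeffX ψ r (z + ⌊u⌋)) = fourierCoeffX ψ (r + ⌊u⌋ * n) :=
      funext fun z => fourierCoeffX_add_int hq r ⌊u⌋ z
    rw [← iteratedDeriv_fourierCoeffX hψ, ← h1, iteratedDeriv_comp_add_const]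
    simp only [Int.fract_add_floor]
  rw [hshift]
  set m := ⌊u⌋
  have h := hC (r + m * n) (Int.fract u) ⟨Int.fract_nonneg u, (Int.fract_lt_one u).le⟩
  have hu : ‖u‖ ≤ (1 + |(r : ℝ)|) * (1 + |((r + m * n : ℤ) : ℝ)|) := by
    have hn1 : (1 : ℝ) ≤ |(n : ℝ)| := by exact_mod_cast Int.one_le_abs hn
    have h1 : |u| ≤ 1 + |(m : ℝ)| := by
      have : u = Int.fract u + m := (Int.fract_add_floor u).symm
      calc |u| ≤ |Int.fract u| + |(m : ℝ)| := by conv_lhs => rw [this]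
                                                 exact abs_add_le _ _
        _ ≤ 1 + |(m : ℝ)| := by
          rw [abs_of_nonneg (Int.fract_nonneg u)]
          linarith [Int.fract_lt_one u]
    have h2 : |(m : ℝ)| ≤ |(m : ℝ) * n| := by
      rw [abs_mul]
      exact le_mul_of_one_le_right (abs_nonneg _) hn1
    have h3 : |(m : ℝ) * n| ≤ |((r + m * n : ℤ) : ℝ)| + |(r : ℝ)| := by
      have := abs_sub ((r + m * n : ℤ) : ℝ) (r : ℝ)
      rwa [show ((r + m * n : ℤ) : ℝ) - r = m * n by push_cast; ring] at this
    rw [Real.norm_eq_abs]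
    nlinarith [mul_nonneg (abs_nonneg (r : ℝ)) (abs_nonneg ((r + m * n : ℤ) : ℝ))]
  calc ‖u‖ ^ a * ‖fourierCoeffX (partialY^[j] ψ) (r + m * n) (Int.fract u)‖
      ≤ ((1 + |(r : ℝ)|) * (1 + |((r + m * n : ℤ) : ℝ)|)) ^ a *
          ‖fourierCoeffX (partialY^[j] ψ) (r + m * n) (Int.fract u)‖ := by gcongr
    _ = (1 + |(r : ℝ)|) ^ a * ((1 + |((r + m * n : ℤ) : ℝ)|) ^ a *
          ‖fourierCoeffX (partialY^[j] ψ) (r + m * n) (Int.fract u)‖) := by rw [mul_pow, mul_assoc]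
    _ ≤ _ := by gcongr

/-- Every smooth quasi-periodic function `ψ` is a Weil–Brezin–Zak series. -/
theorem exists_hasSum_zakTerm {ψ : ℝ × ℝ → ℂ} (hψ : ContDiff ℝ ∞ ψ)
    (hper : Function.Periodic ψ (1, 0)) {n : ℤ} (hn : n ≠ 0)
    (hq : ∀ x y, ψ (x, y + 1) = Complex.exp (-(2 * (Real.pi : ℂ) * Complex.I * n * x)) * ψ (x, y)) :
    ∃ g : SchwartzRZMod n, ∀ x y, HasSum (zakTerm n g x y) (ψ (x, y)) := by
  choose G hG using exists_schwartzMap_eq_fourierCoeffX hψ hper hn hq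
  have hn' : (n : ℝ) ≠ 0 := by exact_mod_cast hn
  -- Any representative `r` of `j` in `ℤ` gives the same function `y ↦ ψ̂_r(y - r/n)`.
  refine ⟨fun j => (G j.cast).compSubConstCLM ℝ (((j.cast : ℤ) : ℝ) / n), fun x y => ?_⟩
  convert hasSum_fourierCoeffX hψ hper x y using 1
  ext k
  rw [zakTerm, SchwartzMap.compSubConstCLM_apply, hG]
  congr 1
  obtain ⟨m, hm⟩ : n ∣ k - ((k : ZMod n.natAbs).cast : ℤ) := by
    rw [← Int.natAbs_dvd, ← ZMod.intCast_eq_intCast_iff_dvd_sub, ZMod.intCast_zmod_cast]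
  generalize ((k : ZMod n.natAbs).cast : ℤ) = r at *
  obtain rfl : k = r + m * n := by linarith
  rw [← fourierCoeffX_add_int hq]
  congr 1
  push_cast
  field_simp
  ring

/-! ### The Weil–Brezin–Zak series of a Schwartz function -/

/-- The Weil–Brezin–Zak series `∑ₖ kᵃ e^{2πikx} g(y + k/n; k)`. The weight `kᵃ`, up to a constant,
is the effect of `∂ᵃ/∂xᵃ`, so that the family of these series is closed under differentiation. -/
noncomputable def zakSum (n : ℤ) (a : ℕ) (g : SchwartzRZMod n) (p : ℝ × ℝ) : ℂ :=
  ∑' k : ℤ, (k : ℂ) ^ a * zakTerm n g p.1 p.2 k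

theorem norm_zakTerm (n : ℤ) (g : SchwartzRZMod n) (x y : ℝ) (k : ℤ) :
    ‖zakTerm n g x y k‖ = ‖g (k : ZMod n.natAbs) (y + (k : ℝ) / (n : ℝ))‖ := by
  rw [zakTerm, norm_mul, norm_exp_two_pi_I_mul, one_mul]

/-- For bounded `y` the argument `y + k/n` grows like `|k|`, so Schwartz decay is rapid decay
in `k`. -/
theorem exists_zakTerm_bound {n : ℤ} (hn : n ≠ 0) (g : SchwartzRZMod n) (a : ℕ) (R : ℝ) :
    ∃ C : ℝ, ∀ (k : ℤ) (x y : ℝ), |y| ≤ R →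
      (1 + |(k : ℝ)|) ^ a * ‖zakTerm n g x y k‖ ≤ C := by
  have : NeZero n.natAbs := ⟨Int.natAbs_ne_zero.2 hn⟩
  have hg : ∀ j, ∃ D : ℝ, ∀ v, (1 + |v|) ^ a * ‖g j v‖ ≤ D := fun j =>
    ⟨_, fun v => by
      simpa using SchwartzMap.one_add_le_sup_seminorm_apply (𝕜 := ℝ) (m := (a, 0)) (k := a) (n := 0)
        le_rfl le_rfl (g j) v⟩
  choose D hD using hg
  obtain ⟨B, hB⟩ := Finite.bddAbove_range D
  refine ⟨(|(n : ℝ)| * (1 + R)) ^ a * B, fun k x y hy => ?_⟩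
  rw [norm_zakTerm]
  have hn0 : (n : ℝ) ≠ 0 := by exact_mod_cast hn
  have hn1 : (1 : ℝ) ≤ |(n : ℝ)| := by exact_mod_cast Int.one_le_abs hn
  have hR : 0 ≤ R := (abs_nonneg y).trans hy
  set v := y + (k : ℝ) / n with hv
  have hk : 1 + |(k : ℝ)| ≤ |(n : ℝ)| * (1 + R) * (1 + |v|) := by
    have h1 : (k : ℝ) = n * (v - y) := by rw [hv]; field_simp; ring
    have h2 : |(k : ℝ)| ≤ |(n : ℝ)| * (|v| + R) := by
      rw [h1, abs_mul]
      gcongr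
      exact (abs_sub v y).trans (by linarith)
    have h3 : 0 ≤ |(n : ℝ)| * (R * |v|) := by positivity
    nlinarith
  calc (1 + |(k : ℝ)|) ^ a * ‖g k v‖
      ≤ (|(n : ℝ)| * (1 + R) * (1 + |v|)) ^ a * ‖g k v‖ := by gcongr
    _ = (|(n : ℝ)| * (1 + R)) ^ a * ((1 + |v|) ^ a * ‖g k v‖) := by rw [mul_pow, mul_assoc]
    _ ≤ (|(n : ℝ)| * (1 + R)) ^ a * B := by
      gcongr
      exact (hD _ v).trans (hB ⟨_, rfl⟩)

/-- A summable majorant of the weighted series, uniform for `y` in a bounded set. -/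
theorem exists_zakTerm_le {n : ℤ} (hn : n ≠ 0) (g : SchwartzRZMod n) (a : ℕ) (R : ℝ) :
    ∃ C : ℝ, ∀ (k : ℤ) (x y : ℝ), |y| ≤ R →
      ‖(k : ℂ) ^ a * zakTerm n g x y k‖ ≤ C * ((1 + |(k : ℝ)|) ^ 2)⁻¹ := by
  obtain ⟨C, hC⟩ := exists_zakTerm_bound hn g (a + 2) R
  refine ⟨C, fun k x y hy => ?_⟩
  rw [← div_eq_mul_inv, le_div_iff₀ (by positivity), norm_mul, norm_pow, Complex.norm_intCast]
  calc |(k : ℝ)| ^ a * ‖zakTerm n g x y k‖ * (1 + |(k : ℝ)|) ^ 2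
      ≤ (1 + |(k : ℝ)|) ^ a * ‖zakTerm n g x y k‖ * (1 + |(k : ℝ)|) ^ 2 := by
        gcongr
        linarith
    _ = (1 + |(k : ℝ)|) ^ (a + 2) * ‖zakTerm n g x y k‖ := by ring
    _ ≤ C := hC k x y hy

theorem summable_pow_mul_zakTerm {n : ℤ} (hn : n ≠ 0) (g : SchwartzRZMod n) (a : ℕ) (x y : ℝ) :
    Summable fun k : ℤ => (k : ℂ) ^ a * zakTerm n g x y k := by
  obtain ⟨C, hC⟩ := exists_zakTerm_le hn g a |y|
  exact Summable.of_norm_bounded (summable_inv_one_add_abs_int_sq.mul_left C)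
    fun k => hC k x y le_rfl

theorem summable_zakTerm {n : ℤ} (hn : n ≠ 0) (g : SchwartzRZMod n) (x y : ℝ) :
    Summable (zakTerm n g x y) := by
  simpa using summable_pow_mul_zakTerm hn g 0 x y

/-- The linear form `(u, v) ↦ u * c + v * d` on `ℝ × ℝ`, as a continuous linear function
of `(c, d)`. -/
noncomputable def gradientForm : ℂ × ℂ →L[ℝ] (ℝ × ℝ →L[ℝ] ℂ) :=
  (ContinuousLinearMap.smulRightL ℝ (ℝ × ℝ) ℂ (ContinuousLinearMap.fst ℝ ℝ ℝ)).comp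
      (ContinuousLinearMap.fst ℝ ℂ ℂ) +
    (ContinuousLinearMap.smulRightL ℝ (ℝ × ℝ) ℂ (ContinuousLinearMap.snd ℝ ℝ ℝ)).comp
      (ContinuousLinearMap.snd ℝ ℂ ℂ)

theorem gradientForm_apply (c : ℂ × ℂ) (v : ℝ × ℝ) :
    gradientForm c v = v.1 * c.1 + v.2 * c.2 := by
  simp [gradientForm]

/-- The derivative `∂g/∂y` on `ℝ × ℤ/nℤ`. -/
noncomputable def SchwartzRZMod.deriv {n : ℤ} (g : SchwartzRZMod n) : SchwartzRZMod n :=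
  fun j => SchwartzMap.derivCLM ℝ ℂ (g j)

theorem hasFDerivAt_zakTerm {n : ℤ} (g : SchwartzRZMod n) (a : ℕ) (k : ℤ) (p : ℝ × ℝ) :
    HasFDerivAt (fun p : ℝ × ℝ => (k : ℂ) ^ a * zakTerm n g p.1 p.2 k)
      (gradientForm (2 * (Real.pi : ℂ) * Complex.I * ((k : ℂ) ^ (a + 1) * zakTerm n g p.1 p.2 k),
        (k : ℂ) ^ a * zakTerm n g.deriv p.1 p.2 k)) p := by
  have h1 : HasFDerivAt (fun p : ℝ × ℝ => Complex.exp (2 * (Real.pi : ℂ) * Complex.I * k * p.1))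
      ((ContinuousLinearMap.fst ℝ ℝ ℝ).smulRight
        (Complex.exp (2 * (Real.pi : ℂ) * Complex.I * k * p.1) *
          (2 * (Real.pi : ℂ) * Complex.I * k))) p := by
    have h : HasDerivAt (fun x : ℝ => Complex.exp (2 * (Real.pi : ℂ) * Complex.I * k * x))
        (Complex.exp (2 * (Real.pi : ℂ) * Complex.I * k * p.1) *
          (2 * (Real.pi : ℂ) * Complex.I * k)) p.1 := by
      simpa using
        ((hasDerivAt_id p.1).ofReal_comp.const_mul (2 * (Real.pi : ℂ) * Complex.I * k)).cexp
    convert! h.hasFDerivAt.comp p (hasFDerivAt_fst (𝕜 := ℝ)) using 1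
  have h2 : HasFDerivAt (fun p : ℝ × ℝ => g k (p.2 + (k : ℝ) / n))
      ((ContinuousLinearMap.snd ℝ ℝ ℝ).smulRight (g.deriv k (p.2 + (k : ℝ) / n))) p := by
    have h : HasDerivAt (fun y : ℝ => g k (y + (k : ℝ) / n)) (g.deriv k (p.2 + (k : ℝ) / n)) p.2 :=
      ((g k).differentiableAt.hasDerivAt (x := p.2 + (k : ℝ) / n)).comp_add_const p.2 _
    convert! h.hasFDerivAt.comp p (hasFDerivAt_snd (𝕜 := ℝ)) using 1
  convert! (h1.mul h2).const_mul ((k : ℂ) ^ a) using 1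
  ext
  · simp [gradientForm_apply, zakTerm]
    ring
  · simp [gradientForm_apply, zakTerm]

/-- Both partial derivatives of a weighted series are again series of this kind, for the weight
`a + 1` and for the Schwartz function `∂g/∂y`; smoothness follows by induction. -/
theorem hasFDerivAt_zakSum {n : ℤ} (hn : n ≠ 0) (g : SchwartzRZMod n) (a : ℕ) (p : ℝ × ℝ) :
    HasFDerivAt (zakSum n a g)
      (gradientForm (2 * (Real.pi : ℂ) * Complex.I * zakSum n (a + 1) g p, zakSum n a g.deriv p))
      p := by
  obtain ⟨C₁, h₁⟩ := exists_zakTerm_le hn g (a + 1) (|p.2| + 1)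
  obtain ⟨C₂, h₂⟩ := exists_zakTerm_le hn g.deriv a (|p.2| + 1)
  have hs := summable_inv_one_add_abs_int_sq
  have key := hasFDerivAt_tsum_of_isPreconnected (𝕜 := ℝ)
    (u := fun k : ℤ => ‖gradientForm‖ * (2 * Real.pi * (C₁ * ((1 + |(k : ℝ)|) ^ 2)⁻¹) +
      C₂ * ((1 + |(k : ℝ)|) ^ 2)⁻¹))
    (f := fun (k : ℤ) (p : ℝ × ℝ) => (k : ℂ) ^ a * zakTerm n g p.1 p.2 k)
    (s := Metric.ball p 1) (x₀ := p) (x := p)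
    ((((hs.mul_left C₁).mul_left _).add (hs.mul_left C₂)).mul_left _) Metric.isOpen_ball
    (convex_ball p 1).isPreconnected (fun k q _ => hasFDerivAt_zakTerm g a k q)
    (fun k q hq => ?_) (Metric.mem_ball_self one_pos)
    (summable_pow_mul_zakTerm hn g a p.1 p.2) (Metric.mem_ball_self one_pos)
  · convert! key using 1
    have s₁ := (summable_pow_mul_zakTerm hn g (a + 1) p.1 p.2).hasSum.mul_left
      (2 * (Real.pi : ℂ) * Complex.I)
    have s₂ := (summable_pow_mul_zakTerm hn g.deriv a p.1 p.2).hasSum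
    exact (gradientForm.hasSum (s₁.prodMk s₂)).tsum_eq.symm
  · have hy : |q.2| ≤ |p.2| + 1 := by
      have h : dist q.2 p.2 ≤ dist q p := le_max_right _ _
      rw [Real.dist_eq] at h
      have := abs_sub_abs_le_abs_sub q.2 p.2
      linarith [Metric.mem_ball.1 hq]
    refine (gradientForm.le_opNorm _).trans (mul_le_mul_of_nonneg_left ?_ (norm_nonneg _))
    have e₁ := h₁ k q.1 q.2 hy
    have e₂ := h₂ k q.1 q.2 hy
    refine (norm_prod_le_iff (r := _)).2 ⟨?_, ?_⟩
    · rw [norm_mul, show ‖2 * (Real.pi : ℂ) * Complex.I‖ = 2 * Real.pi by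
        simp [abs_of_pos Real.pi_pos]]
      have := (norm_nonneg _).trans e₂
      have : 2 * Real.pi * ‖(k : ℂ) ^ (a + 1) * zakTerm n g q.1 q.2 k‖ ≤
        2 * Real.pi * (C₁ * ((1 + |(k : ℝ)|) ^ 2)⁻¹) := by gcongr
      linarith
    · have := (norm_nonneg _).trans e₁
      have : 0 ≤ 2 * Real.pi * (C₁ * ((1 + |(k : ℝ)|) ^ 2)⁻¹) := by positivity
      linarith

theorem contDiff_zakSum {n : ℤ} (hn : n ≠ 0) (g : SchwartzRZMod n) (a : ℕ) :
    ContDiff ℝ ∞ (zakSum n a g) := by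
  rw [contDiff_infty]
  intro m
  induction m generalizing g a with
  | zero =>
    exact contDiff_zero.2 (continuous_iff_continuousAt.2 fun p =>
      (hasFDerivAt_zakSum hn g a p).continuousAt)
  | succ m ih =>
    push_cast
    rw [contDiff_succ_iff_hasFDerivAt]
    exact ⟨_, gradientForm.contDiff.comp ((contDiff_const.mul (ih g (a + 1))).prodMk
      (ih g.deriv a)), hasFDerivAt_zakSum hn g a⟩

theorem periodic_zakSum {n : ℤ} (g : SchwartzRZMod n) :
    Function.Periodic (zakSum n 0 g) (1, 0) := by
  intro p
  unfold zakSum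
  congr 1
  ext k
  simp only [zakTerm, Prod.fst_add, Prod.snd_add, add_zero]
  push_cast
  rw [mul_add, mul_one, Complex.exp_add]
  have : Complex.exp (2 * (Real.pi : ℂ) * Complex.I * k) = 1 := by
    simpa using exp_two_pi_I_mul_int k 1
  rw [this, mul_one]

/-- The quasi-period in `y`: replacing `y` by `y + 1` is the reindexing `k ↦ k + n`, which
preserves the class of `k` modulo `n`. -/
theorem zakSum_add_one {n : ℤ} (hn : n ≠ 0) (g : SchwartzRZMod n) (x y : ℝ) :
    zakSum n 0 g (x, y + 1) =
      Complex.exp (-(2 * (Real.pi : ℂ) * Complex.I * n * x)) * zakSum n 0 g (x, y) := by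
  have hn' : (n : ℝ) ≠ 0 := by exact_mod_cast hn
  unfold zakSum
  rw [← tsum_mul_left, ← (Equiv.addRight n).tsum_eq
    (fun k : ℤ => Complex.exp (-(2 * (Real.pi : ℂ) * Complex.I * n * x)) *
      ((k : ℂ) ^ 0 * zakTerm n g (x, y).1 (x, y).2 k))]
  congr 1
  ext k
  have hk : ((k + n : ℤ) : ZMod n.natAbs) = k := by
    rw [ZMod.intCast_eq_intCast_iff_dvd_sub, Int.natAbs_dvd]
    exact ⟨-1, by ring⟩
  simp only [zakTerm, Equiv.coe_addRight, pow_zero, one_mul, hk]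
  rw [← mul_assoc, ← Complex.exp_add]
  congr 2
  · push_cast; ring
  · push_cast; field_simp; ring

theorem integral_exp_two_pi_I_mul (k : ℤ) :
    ∫ x in (0 : ℝ)..1, Complex.exp (2 * (Real.pi : ℂ) * Complex.I * k * x) =
      if k = 0 then 1 else 0 := by
  split_ifs with hk
  · simp [hk]
  · rw [integral_exp_mul_complex (by simp [hk, Real.pi_ne_zero])]
    have : Complex.exp (2 * (Real.pi : ℂ) * Complex.I * k) = 1 := by
      simpa using exp_two_pi_I_mul_int k 1
    simp [this]

/-- The Schwartz functions are recovered as the Fourier coefficients of their Weil–Brezin–Zak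
series. -/
theorem fourierCoeffX_zakSum {n : ℤ} (hn : n ≠ 0) (g : SchwartzRZMod n) (k : ℤ) (y : ℝ) :
    fourierCoeffX (zakSum n 0 g) k y = g k (y + (k : ℝ) / n) := by
  obtain ⟨C, hC⟩ := exists_zakTerm_le hn g 0 |y|
  let F : ℤ → C(ℝ, ℂ) := fun l =>
    ⟨fun x => Complex.exp (-(2 * (Real.pi : ℂ) * Complex.I * k * x)) * zakTerm n g x y l, by
      unfold zakTerm; fun_prop⟩
  have hF : ∀ l x, ‖F l x‖ ≤ C * ((1 + |(l : ℝ)|) ^ 2)⁻¹ := fun l x => by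
    have := hC l x y le_rfl
    rw [pow_zero, one_mul] at this
    simpa only [F, ContinuousMap.coe_mk, norm_mul, norm_exp_neg_two_pi_I_mul, one_mul] using this
  have key := intervalIntegral.hasSum_intervalIntegral_of_summable_norm (a := 0) (b := 1) (f := F)
    (Summable.of_nonneg_of_le (fun _ => norm_nonneg _) (fun l => by
      rw [ContinuousMap.norm_le _ ((norm_nonneg _).trans (hF l 0))]
      exact fun x => hF l x) (summable_inv_one_add_abs_int_sq.mul_left C))
  have hint : ∀ l, ∫ x in (0 : ℝ)..1, F l x = if l = k then g k (y + (k : ℝ) / n) else 0 := by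
    intro l
    have : ∀ x : ℝ, F l x = Complex.exp (2 * (Real.pi : ℂ) * Complex.I * (l - k : ℤ) * x) *
        g l (y + (l : ℝ) / n) := fun x => by
      simp only [F, ContinuousMap.coe_mk, zakTerm, ← mul_assoc, ← Complex.exp_add]
      congr 2; push_cast; ring
    simp only [this, intervalIntegral.integral_mul_const, integral_exp_two_pi_I_mul, sub_eq_zero]
    split_ifs with h
    · rw [h, one_mul]
    · rw [zero_mul]
  simp only [hint] at key
  rw [(hasSum_ite_eq k (g k (y + (k : ℝ) / n))).unique key]
  unfold fourierCoeffX zakSum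
  congr 1
  ext x
  simp only [pow_zero, one_mul, F, ContinuousMap.coe_mk, tsum_mul_left]

theorem zakSum_injective {n : ℤ} (hn : n ≠ 0) : Function.Injective (zakSum n 0) := by
  intro g g' h
  ext j v
  have e := fourierCoeffX_zakSum hn g j.cast (v - ((j.cast : ℤ) : ℝ) / n)
  rw [h, fourierCoeffX_zakSum hn, sub_add_cancel, ZMod.intCast_zmod_cast] at e
  exact e.symm

/-! ### Functions on the nilmanifold -/

namespace Heis

/-- The coordinate `x` of `z = x + τ y`. -/
noncomputable def coordX (τ z : ℂ) : ℝ := z.re - τ.re * (z.im / τ.im)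

/-- The coordinate `y` of `z = x + τ y`. -/
noncomputable def coordY (τ z : ℂ) : ℝ := z.im / τ.im

theorem coordX_add_coordY {τ : ℂ} (hτ : τ.im ≠ 0) (z : ℂ) :
    (coordX τ z : ℂ) + τ * (coordY τ z : ℂ) = z := by
  apply Complex.ext
  · simp [coordX, coordY]
  · simp [coordX, coordY]; field_simp

theorem coordX_of_add {τ : ℂ} (hτ : τ.im ≠ 0) (x y : ℝ) :
    coordX τ ((x : ℂ) + τ * (y : ℂ)) = x := by
  simp [coordX]; field_simp; ring

theorem coordY_of_add {τ : ℂ} (hτ : τ.im ≠ 0) (x y : ℝ) :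
    coordY τ ((x : ℂ) + τ * (y : ℂ)) = y := by
  simp [coordY]; field_simp

/-- The function `e^{πin(t/Im τ + xy)} ψ(x, y)` on `H₃(ℝ)`, where `z = x + τ y`. -/
noncomputable def ofCoord (τ : ℂ) (n : ℤ) (ψ : ℝ × ℝ → ℂ) (p : Heis) : ℂ :=
  Complex.exp ((Real.pi : ℂ) * Complex.I * (n : ℂ) *
    ((p.t : ℂ) / (τ.im : ℂ) + (coordX τ p.z : ℂ) * (coordY τ p.z : ℂ))) *
      ψ (coordX τ p.z, coordY τ p.z)

/-- A function on a group that is invariant under right multiplication by generators of a subgroup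
is invariant under right multiplication by the subgroup. -/
theorem _root_.Subgroup.apply_mul_eq_of_mem_closure {G α : Type*} [Group G] {S : Set G}
    {F : G → α} (hS : ∀ s ∈ S, ∀ p, F (p * s) = F p) {h : G} (hh : h ∈ Subgroup.closure S) (p : G) :
    F (p * h) = F p := by
  induction hh using Subgroup.closure_induction generalizing p with
  | mem s hs => exact hS s hs p
  | one => rw [mul_one]
  | mul a b _ _ ha hb => rw [← mul_assoc, hb, ha]
  | inv a _ ha => rw [← ha, inv_mul_cancel_right]

/-- The two quasi-periods of `ψ` are the invariance of `ofCoord τ n ψ` under the two generators of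
the lattice: the phase `e^{πin(t/Im τ + xy)}` is unchanged by `(1, 0)` and acquires the factor
`e^{2πinx}` from `(τ, 0)`. -/
theorem ofCoord_mul {τ : ℂ} (hτ : τ.im ≠ 0) {n : ℤ} {ψ : ℝ × ℝ → ℂ}
    (hper : Function.Periodic ψ (1, 0))
    (hq : ∀ x y, ψ (x, y + 1) = Complex.exp (-(2 * (Real.pi : ℂ) * Complex.I * n * x)) * ψ (x, y))
    (p h : Heis) (hh : h ∈ latticeSubgroup τ) : ofCoord τ n ψ (p * h) = ofCoord τ n ψ p := by
  refine Subgroup.apply_mul_eq_of_mem_closure ?_ hh p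
  rintro s (rfl | rfl) p <;> obtain ⟨z, t⟩ := p <;>
    obtain ⟨x, y, rfl⟩ : ∃ x y : ℝ, z = (x : ℂ) + τ * (y : ℂ) :=
      ⟨_, _, (coordX_add_coordY hτ z).symm⟩
  · have hz : (x : ℂ) + τ * (y : ℂ) + 1 = ((x + 1 : ℝ) : ℂ) + τ * (y : ℂ) := by push_cast; ring
    have hψ : ψ (x + 1, y) = ψ (x, y) := by simpa using hper (x, y)
    simp only [ofCoord, mul_z, mul_t, hz, coordX_of_add hτ, coordY_of_add hτ, hψ]
    congr 3
    have : ((τ.im : ℝ) : ℂ) ≠ 0 := by exact_mod_cast hτ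
    simp
    field_simp
    ring
  · have hz : (x : ℂ) + τ * (y : ℂ) + τ = (x : ℂ) + τ * ((y + 1 : ℝ) : ℂ) := by push_cast; ring
    simp only [ofCoord, mul_z, mul_t, hz, coordX_of_add hτ, coordY_of_add hτ, hq]
    rw [← mul_assoc, ← Complex.exp_add]
    congr 2
    have : ((τ.im : ℝ) : ℂ) ≠ 0 := by exact_mod_cast hτ
    simp
    field_simp
    ring

/-- The function on the left cosets of `H₃(ℤ)` with pullback `ofCoord τ n ψ`, for quasi-periodic `ψ`. -/
noncomputable def descend {τ : ℂ} (hτ : τ.im ≠ 0) {n : ℤ} {ψ : ℝ × ℝ → ℂ}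
    (hper : Function.Periodic ψ (1, 0))
    (hq : ∀ x y, ψ (x, y + 1) = Complex.exp (-(2 * (Real.pi : ℂ) * Complex.I * n * x)) * ψ (x, y)) :
    M3 τ → ℂ :=
  Quotient.lift (ofCoord τ n ψ) fun a b hab => by
    have h := ofCoord_mul hτ hper hq a _ (QuotientGroup.leftRel_apply.1 hab)
    rw [mul_inv_cancel_left] at h
    exact h.symm

theorem descend_mem_weightSpace {τ : ℂ} (hτ : τ.im ≠ 0) {n : ℤ} {ψ : ℝ × ℝ → ℂ}
    (hψ : ContDiff ℝ ∞ ψ) (hper : Function.Periodic ψ (1, 0))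
    (hq : ∀ x y, ψ (x, y + 1) = Complex.exp (-(2 * (Real.pi : ℂ) * Complex.I * n * x)) * ψ (x, y)) :
    descend hτ hper hq ∈ weightSpace τ n := by
  have hpull : ∀ p : ℂ × ℝ, pullback (descend hτ hper hq) p = ofCoord τ n ψ ⟨p.1, p.2⟩ :=
    fun _ => rfl
  refine ⟨?_, fun p => ?_⟩
  · change ContDiff ℝ ∞ (pullback _)
    rw [funext hpull]
    have hre : ContDiff ℝ ∞ fun p : ℂ × ℝ => p.1.re := Complex.reCLM.contDiff.comp contDiff_fst
    have him : ContDiff ℝ ∞ fun p : ℂ × ℝ => p.1.im := Complex.imCLM.contDiff.comp contDiff_fst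
    have hy : ContDiff ℝ ∞ fun p : ℂ × ℝ => coordY τ p.1 := him.div_const _
    have hx : ContDiff ℝ ∞ fun p : ℂ × ℝ => coordX τ p.1 := hre.sub (contDiff_const.mul hy)
    have hc : ∀ {u : ℂ × ℝ → ℝ}, ContDiff ℝ ∞ u → ContDiff ℝ ∞ fun p => (u p : ℂ) :=
      fun hu => Complex.ofRealCLM.contDiff.comp hu
    exact (contDiff_const.mul (((hc contDiff_snd).div_const _).add ((hc hx).mul (hc hy)))).cexp.mul
      (hψ.comp (hx.prodMk hy))
  · simp only [tField, hpull, ofCoord]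
    have h := ((((hasDerivAt_id p.2).ofReal_comp.div_const (τ.im : ℂ)).add_const
      ((coordX τ p.1 : ℂ) * (coordY τ p.1 : ℂ))).const_mul
      ((Real.pi : ℂ) * Complex.I * (n : ℂ))).cexp.mul_const (ψ (coordX τ p.1, coordY τ p.1))
    simp only [id] at h
    -- `deriv` is taken of a function that is differentiable, so it has its true value.
    rw [h.deriv]
    have : ((τ.im : ℝ) : ℂ) ≠ 0 := by exact_mod_cast hτ
    have hpi : (Real.pi : ℂ) ≠ 0 := by exact_mod_cast Real.pi_ne_zero
    field_simp
    simp

theorem contDiff_pullback {τ : ℂ} {n : ℤ} {f : M3 τ → ℂ} (hf : f ∈ weightSpace τ n) :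
    ContDiff ℝ ∞ (pullback f) :=
  hf.1

/-- Integrating the equation `𝔱 f = n f` along the centre. -/
theorem apply_eq_exp_mul {τ : ℂ} (hτ : τ.im ≠ 0) {n : ℤ} {f : M3 τ → ℂ} (hf : f ∈ weightSpace τ n)
    (z : ℂ) (t : ℝ) : f (QuotientGroup.mk (⟨z, t⟩ : Heis)) =
      Complex.exp ((Real.pi : ℂ) * Complex.I * n * (t / (τ.im : ℂ))) *
        f (QuotientGroup.mk (⟨z, 0⟩ : Heis)) := by
  have hτ' : ((τ.im : ℝ) : ℂ) ≠ 0 := by exact_mod_cast hτ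
  have hpi : (Real.pi : ℂ) ≠ 0 := by exact_mod_cast Real.pi_ne_zero
  have hdiff : Differentiable ℝ fun s : ℝ => pullback f (z, s) :=
    (contDiff_pullback hf).differentiable (by simp) |>.comp (by fun_prop)
  have hder : ∀ s : ℝ, HasDerivAt (fun s : ℝ => pullback f (z, s))
      ((Real.pi : ℂ) * Complex.I * n / τ.im * pullback f (z, s)) s := fun s => by
    have h := hf.2 (z, s)
    simp only [tField] at h
    convert! (hdiff s).hasDerivAt using 1
    field_simp at h ⊢
    linear_combination -h
  have hexp : ∀ s : ℝ, HasDerivAt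
      (fun s : ℝ => Complex.exp (-((Real.pi : ℂ) * Complex.I * n * (s / (τ.im : ℂ)))))
      (Complex.exp (-((Real.pi : ℂ) * Complex.I * n * (s / (τ.im : ℂ)))) *
        -((Real.pi : ℂ) * Complex.I * n * (1 / (τ.im : ℂ)))) s := fun s =>
    (((hasDerivAt_id s).ofReal_comp.div_const (τ.im : ℂ)).const_mul
      ((Real.pi : ℂ) * Complex.I * n)).fun_neg.cexp
  have hprod := fun s => (hexp s).fun_mul (hder s)
  have hconst := is_const_of_deriv_eq_zero (fun s => (hprod s).differentiableAt)
    (fun s => by rw [(hprod s).deriv]; field_simp; ring) t 0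
  simp only [pullback, Complex.exp_neg] at hconst
  rw [inv_mul_eq_iff_eq_mul₀ (Complex.exp_ne_zero _)] at hconst
  simpa using hconst

/-- The quasi-periodic function `ψ` with `f(x + τ y, t) = e^{πin(t/Im τ + xy)} ψ(x, y)`. -/
noncomputable def toCoord {τ : ℂ} (n : ℤ) (f : M3 τ → ℂ) (p : ℝ × ℝ) : ℂ :=
  Complex.exp (-((Real.pi : ℂ) * Complex.I * n * (p.1 * p.2))) *
    f (QuotientGroup.mk (⟨(p.1 : ℂ) + τ * (p.2 : ℂ), 0⟩ : Heis))

theorem apply_eq_exp_mul_toCoord {τ : ℂ} (hτ : τ.im ≠ 0) {n : ℤ} {f : M3 τ → ℂ}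
    (hf : f ∈ weightSpace τ n) (x y t : ℝ) :
    f (QuotientGroup.mk (⟨(x : ℂ) + τ * (y : ℂ), t⟩ : Heis)) =
      Complex.exp ((Real.pi : ℂ) * Complex.I * (n : ℂ) *
        ((t : ℂ) / (τ.im : ℂ) + (x : ℂ) * (y : ℂ))) * toCoord n f (x, y) := by
  rw [apply_eq_exp_mul hτ hf, toCoord, ← mul_assoc, ← Complex.exp_add]
  congr 2
  ring

theorem contDiff_toCoord {τ : ℂ} {n : ℤ} {f : M3 τ → ℂ} (hf : f ∈ weightSpace τ n) :
    ContDiff ℝ ∞ (toCoord n f) := by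
  have hc : ∀ {u : ℝ × ℝ → ℝ}, ContDiff ℝ ∞ u → ContDiff ℝ ∞ fun p => (u p : ℂ) :=
    fun hu => Complex.ofRealCLM.contDiff.comp hu
  have hx := hc contDiff_fst
  have hy := hc contDiff_snd
  exact (contDiff_const.mul (hx.mul hy)).neg.cexp.mul
    ((contDiff_pullback hf).comp
      ((hx.add (contDiff_const.mul hy)).prodMk contDiff_const))

theorem periodic_toCoord {τ : ℂ} (hτ : τ.im ≠ 0) {n : ℤ} {f : M3 τ → ℂ}
    (hf : f ∈ weightSpace τ n) : Function.Periodic (toCoord n f) (1, 0) := by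
  rintro ⟨x, y⟩
  -- Right multiplication by `(1, 0)` changes `t` by `Im (conj z) = -y Im τ`.
  have hmk : (QuotientGroup.mk (⟨(x : ℂ) + τ * (y : ℂ), 0⟩ : Heis) : M3 τ) =
      QuotientGroup.mk (⟨((x + 1 : ℝ) : ℂ) + τ * (y : ℂ), -(τ.im * y)⟩ : Heis) := by
    rw [QuotientGroup.eq]
    convert! Subgroup.subset_closure (Set.mem_insert (⟨1, 0⟩ : Heis) {⟨τ, 0⟩}) using 1
    ext : 1
    · simp
      ring
    · simp
      ring
  have h₁ := apply_eq_exp_mul_toCoord hτ hf x y 0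
  rw [hmk, apply_eq_exp_mul_toCoord hτ hf] at h₁
  have hτ' : ((τ.im : ℝ) : ℂ) ≠ 0 := by exact_mod_cast hτ
  have he : ((-(τ.im * y) : ℝ) : ℂ) / (τ.im : ℂ) + ((x + 1 : ℝ) : ℂ) * (y : ℂ) =
      ((0 : ℝ) : ℂ) / (τ.im : ℂ) + (x : ℂ) * (y : ℂ) := by
    push_cast; field_simp; ring
  rw [he] at h₁
  simpa using mul_left_cancel₀ (Complex.exp_ne_zero _) h₁

theorem toCoord_add_one {τ : ℂ} (hτ : τ.im ≠ 0) {n : ℤ} {f : M3 τ → ℂ}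
    (hf : f ∈ weightSpace τ n) (x y : ℝ) : toCoord n f (x, y + 1) =
      Complex.exp (-(2 * (Real.pi : ℂ) * Complex.I * n * x)) * toCoord n f (x, y) := by
  -- Right multiplication by `(τ, 0)` changes `t` by `Im (conj z * τ) = x Im τ`.
  have hmk : (QuotientGroup.mk (⟨(x : ℂ) + τ * (y : ℂ), 0⟩ : Heis) : M3 τ) =
      QuotientGroup.mk (⟨(x : ℂ) + τ * ((y + 1 : ℝ) : ℂ), τ.im * x⟩ : Heis) := by
    rw [QuotientGroup.eq]
    convert! Subgroup.subset_closure (Set.mem_insert_of_mem (⟨1, 0⟩ : Heis)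
      (Set.mem_singleton (⟨τ, 0⟩ : Heis))) using 1
    ext : 1
    · simp
      ring
    · simp
      ring
  have h₁ := apply_eq_exp_mul_toCoord hτ hf x y 0
  rw [hmk, apply_eq_exp_mul_toCoord hτ hf] at h₁
  have hτ' : ((τ.im : ℝ) : ℂ) ≠ 0 := by exact_mod_cast hτ
  have he : (Real.pi : ℂ) * Complex.I * n * (((τ.im * x : ℝ) : ℂ) / (τ.im : ℂ) +
      (x : ℂ) * ((y + 1 : ℝ) : ℂ)) = (Real.pi : ℂ) * Complex.I * n *
        (((0 : ℝ) : ℂ) / (τ.im : ℂ) + (x : ℂ) * (y : ℂ)) + 2 * (Real.pi : ℂ) * Complex.I * n * x := by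
    push_cast; field_simp; ring
  rw [he, Complex.exp_add, mul_assoc] at h₁
  rw [← mul_left_cancel₀ (Complex.exp_ne_zero _) h₁, ← mul_assoc, ← Complex.exp_add]
  simp

/-- The inverse transform: the function on `M₃` given by the Weil–Brezin–Zak series of `g`. -/
noncomputable def ofSchwartz {τ : ℂ} (hτ : τ.im ≠ 0) {n : ℤ} (hn : n ≠ 0) (g : SchwartzRZMod n) :
    weightSpace τ n :=
  ⟨descend hτ (periodic_zakSum g) (zakSum_add_one hn g),
    descend_mem_weightSpace hτ (contDiff_zakSum hn g 0) _ _⟩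

theorem ofSchwartz_apply {τ : ℂ} (hτ : τ.im ≠ 0) {n : ℤ} (hn : n ≠ 0) (g : SchwartzRZMod n)
    (x y t : ℝ) :
    (ofSchwartz hτ hn g : M3 τ → ℂ) (QuotientGroup.mk (⟨(x : ℂ) + τ * (y : ℂ), t⟩ : Heis)) =
      Complex.exp ((Real.pi : ℂ) * Complex.I * (n : ℂ) *
        ((t : ℂ) / (τ.im : ℂ) + (x : ℂ) * (y : ℂ))) * ∑' k : ℤ, zakTerm n g x y k := by
  change ofCoord τ n (zakSum n 0 g) _ = _
  simp only [ofCoord, coordX_of_add hτ, coordY_of_add hτ, zakSum, pow_zero, one_mul]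

theorem ofSchwartz_bijective {τ : ℂ} (hτ : τ.im ≠ 0) {n : ℤ} (hn : n ≠ 0) :
    Function.Bijective (ofSchwartz (τ := τ) hτ hn) := by
  constructor
  · intro g g' h
    refine zakSum_injective hn (funext fun ⟨x, y⟩ => ?_)
    have e := ofSchwartz_apply hτ hn g x y 0
    rw [h, ofSchwartz_apply] at e
    simpa [zakSum] using (mul_left_cancel₀ (Complex.exp_ne_zero _) e).symm
  · rintro ⟨f, hf⟩
    obtain ⟨g, hg⟩ := exists_hasSum_zakTerm (contDiff_toCoord hf) (periodic_toCoord hτ hf) hn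
      (toCoord_add_one hτ hf)
    refine ⟨g, Subtype.ext (funext fun q => ?_)⟩
    induction q using QuotientGroup.induction_on with
    | H p =>
      obtain ⟨z, t⟩ := p
      rw [← coordX_add_coordY hτ z, ofSchwartz_apply hτ, (hg _ _).tsum_eq]
      exact (apply_eq_exp_mul_toCoord hτ hf _ _ t).symm

end Heis

theorem proposition5p2 (τ : ℂ) (hτ : 0 < τ.im) (n : ℤ) (hn : n ≠ 0) :
    ∃ Φ : Heis.weightSpace τ n ≃ SchwartzRZMod n,
      ∀ (f : Heis.weightSpace τ n) (x y t : ℝ),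
        Summable (zakTerm n (Φ f) x y) ∧
        (f : Heis.M3 τ → ℂ) (QuotientGroup.mk (⟨(x : ℂ) + τ * (y : ℂ), t⟩ : Heis)) =
          Complex.exp ((Real.pi : ℂ) * Complex.I * (n : ℂ) *
              ((t : ℂ) / (τ.im : ℂ) + (x : ℂ) * (y : ℂ))) *
            ∑' k : ℤ, zakTerm n (Φ f) x y k := by
  let e := Equiv.ofBijective _ (Heis.ofSchwartz_bijective hτ.ne' hn)
  refine ⟨e.symm, fun f x y t => ⟨summable_zakTerm hn _ x y, ?_⟩⟩
  obtain ⟨g, rfl⟩ := e.surjective f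
  rw [Equiv.symm_apply_apply]
  exact Heis.ofSchwartz_apply hτ.ne' hn g x y t
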